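/- Let $\Gamma$ be a finite simple undirected graph of order $n$ (number of vertices) and of diameter $2$ that has no dominating vertex, i.e. no vertex adjacent to every other vertex. Suppose that $\Gamma$ has exactly $2n-5$ edges. Let $A(\Gamma)$ be the adjacency matrix of $\Gamma$. Then there exists a non-zero vector with all entries in $\{0,1\}$ that lies in the row space of $A(\Gamma)$ over the real numbers and is not equal to any row of $A(\Gamma)$. -/

import Mathlib

namespace SimpleGraph

/-- The row space over the real numbers of the adjacency matrix of `G`. -/
def adjRowSpace {V : Type*} (G : SimpleGraph V) [DecidableRel G.Adj] : Submodule ℝ (V → ℝ) :=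
  Submodule.span ℝ (Set.range (G.adjMatrix ℝ).row)

end SimpleGraph

/-! If some edge lies in no triangle, its two end rows have disjoint supports, and their sum is the
required vector. Otherwise diameter 2 gives every two vertices a common neighbour, and then the
graph has at least 2n - 4 edges, one too many. This bound splits on the minimum degree: degree sums
suffice from 4 on, counting 2-paths settles 3, and degree 2 needs a spanning connected subgraph. -/

namespace SimpleGraph

variable {V : Type*}

/-- Any two distinct vertices of `G` have a common neighbour. -/
def HasCommonNeighbors (G : SimpleGraph V) : Prop :=
  ∀ ⦃u v⦄, u ≠ v → ∃ w, G.Adj u w ∧ G.Adj v w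

/-- In a graph of diameter two in which every edge lies in a triangle, any two vertices have a
common neighbour. -/
lemma hasCommonNeighbors_of_diam_eq_two {G : SimpleGraph V} (hdiam : G.diam = 2)
    (htri : ∀ u v, G.Adj u v → ∃ w, G.Adj u w ∧ G.Adj v w) : G.HasCommonNeighbors := by
  intro u v huv
  by_cases hadj : G.Adj u v
  · exact htri u v hadj
  have htop : G.ediam ≠ ⊤ := ediam_ne_top_of_diam_ne_zero (by omega)
  have hle : G.dist u v ≤ 2 := hdiam ▸ dist_le_diam htop
  have hreach := preconnected_of_ediam_ne_top htop u v
  obtain ⟨p, hp⟩ := hreach.exists_walk_length_eq_dist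
  rw [← hp] at hle
  match p with
  | .nil => exact absurd rfl huv
  | .cons h .nil => exact absurd h hadj
  | .cons h (.cons h' .nil) => exact ⟨_, h, h'.symm⟩
  | .cons _ (.cons _ (.cons _ _)) => simp only [Walk.length_cons] at hle; omega

section Finite

variable [Fintype V] {G : SimpleGraph V} [DecidableRel G.Adj]

lemma HasCommonNeighbors.two_le_degree [Nontrivial V] (hc : G.HasCommonNeighbors) (v : V) :
    2 ≤ G.degree v := by
  obtain ⟨u, hu⟩ := exists_ne v
  obtain ⟨w, hvw, -⟩ := hc hu.symm
  obtain ⟨x, hvx, hwx⟩ := hc hvw.ne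
  rw [← card_neighborFinset_eq_degree, ← Nat.lt_iff_add_one_le, Finset.one_lt_card]
  exact ⟨w, by simpa, x, by simpa, hwx.ne⟩

variable [DecidableEq V]

/-- Double counting of the paths of length two from `v` bounds the total degree below. -/
lemma HasCommonNeighbors.le_two_mul_card_edgeFinset (hc : G.HasCommonNeighbors) {d : ℕ} {v : V}
    (hv : G.degree v = d) (hmin : ∀ w, d ≤ G.degree w) :
    d + (Fintype.card V - 1) + d * (Fintype.card V - d) ≤ 2 * G.edgeFinset.card := by
  have hcount : ∑ a ∈ G.neighborFinset v, G.degree a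
      = ∑ w, (G.neighborFinset v ∩ G.neighborFinset w).card := by
    have := Finset.sum_card_bipartiteAbove_eq_sum_card_bipartiteBelow
      (s := G.neighborFinset v) (t := Finset.univ) (r := G.Adj)
    convert this using 2 with a _ w _
    · rw [← card_neighborFinset_eq_degree]
      congr 1
      ext; simp [Finset.bipartiteAbove]
    · congr 1
      ext x; simp [Finset.bipartiteBelow, adj_comm]
  -- The term `w = v` contributes `d`, and every other `w` at least 1.
  have hnear : d + (Fintype.card V - 1) ≤ ∑ a ∈ G.neighborFinset v, G.degree a := by
    rw [hcount, ← Finset.add_sum_erase _ _ (Finset.mem_univ v), Finset.inter_self,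
      card_neighborFinset_eq_degree, hv, ← Finset.card_univ,
      ← Finset.card_erase_of_mem (Finset.mem_univ v), Finset.card_eq_sum_ones]
    refine Nat.add_le_add_left (Finset.sum_le_sum fun w hw ↦ ?_) _
    obtain ⟨x, hvx, hwx⟩ := hc (Finset.ne_of_mem_erase hw).symm
    exact Finset.card_pos.mpr ⟨x, by simp [hvx, hwx]⟩
  have hfar : d * (Fintype.card V - d) ≤ ∑ a ∈ (G.neighborFinset v)ᶜ, G.degree a := by
    have := Finset.card_nsmul_le_sum (G.neighborFinset v)ᶜ (G.degree ·) d fun w _ ↦ hmin w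
    rwa [Finset.card_compl, card_neighborFinset_eq_degree, hv, smul_eq_mul, mul_comm] at this
  rw [← sum_degrees_eq_twice_card_edges, ← Finset.sum_add_sum_compl (G.neighborFinset v)]
  exact Nat.add_le_add hnear hfar

/-- A graph without universal vertices, in which any two vertices have a common neighbour and some
vertex has degree two, has at least `2 n - 4` edges. -/
lemma HasCommonNeighbors.two_mul_card_le_of_degree_eq_two (hc : G.HasCommonNeighbors)
    (hdom : ¬ ∃ v : V, G.IsUniversal v) {v : V} (hv : G.degree v = 2) :
    2 * Fintype.card V ≤ G.edgeFinset.card + 4 := by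
  rw [← card_neighborFinset_eq_degree, Finset.card_eq_two] at hv
  obtain ⟨a, b, hab, hN⟩ := hv
  have hmem (w : V) : G.Adj v w ↔ w = a ∨ w = b := by
    rw [← mem_neighborFinset, hN]; simp
  have hva : G.Adj v a := (hmem a).2 (.inl rfl)
  have hvb : G.Adj v b := (hmem b).2 (.inr rfl)
  have hcover (w : V) : G.Adj a w ∨ G.Adj b w := by
    by_cases h : v = w
    · exact h ▸ .inl hva.symm
    obtain ⟨x, hvx, hwx⟩ := hc h
    rcases (hmem x).1 hvx with rfl | rfl
    exacts [.inl hwx.symm, .inr hwx.symm]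
  have hadj : G.Adj a b := (hcover b).resolve_right (G.irrefl)
  -- So `x₀` sees only `a`, and `y₀` only `b`, among the two.
  obtain ⟨x₀, hbx₀, hx₀⟩ : ∃ x, b ≠ x ∧ ¬ G.Adj b x := by
    by_contra! h; exact hdom ⟨b, h⟩
  obtain ⟨y₀, hay₀, hy₀⟩ : ∃ y, a ≠ y ∧ ¬ G.Adj a y := by
    by_contra! h; exact hdom ⟨a, h⟩
  have hby₀ : b ≠ y₀ := by rintro rfl; exact hy₀ hadj
  have hax₀ : a ≠ x₀ := by rintro rfl; exact hx₀ hadj.symm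
  -- Deleting one edge at each vertex other than `a`, `b`, `y₀` leaves a connected graph.
  let f : V → Sym2 V := fun x ↦ s(if G.Adj a x then a else b, x)
  let S : Finset V := Finset.univ \ {a, b, y₀}
  let F : SimpleGraph V := G.deleteEdges (S.image f : Finset (Sym2 V))
  have hfG : S.image f ⊆ G.edgeFinset := by
    intro e he
    obtain ⟨x, -, rfl⟩ := Finset.mem_image.1 he
    by_cases h : G.Adj a x
    · simp [f, h]
    · simpa [f, h] using (hcover x).resolve_left h
  have hfinj : Set.InjOn f S := by
    intro x hx y hy hxy
    simp only [S, Finset.coe_sdiff, Finset.coe_univ, Set.mem_sdiff, Set.mem_univ, true_and,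
      Finset.coe_insert, Finset.coe_singleton, Set.mem_insert_iff, Set.mem_singleton_iff,
      not_or] at hx hy
    simp only [f, Sym2.eq_iff] at hxy
    grind
  have hScard : S.card = Fintype.card V - 3 := by
    rw [Finset.card_sdiff_of_subset (Finset.subset_univ _), Finset.card_univ,
      Finset.card_eq_three.2 ⟨a, b, y₀, hab, hay₀, hby₀, rfl⟩]
  have hkeep {x y : V} (h : G.Adj x y) (h' : ∀ z, z ≠ a → z ≠ b → z ≠ y₀ → s(x, y) ≠ f z) :
      F.Adj x y := by
    refine (G.deleteEdges_adj).2 ⟨h, fun he ↦ ?_⟩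
    obtain ⟨z, hz, hzf⟩ := Finset.mem_image.1 (Finset.mem_coe.1 he)
    simp only [S, Finset.mem_sdiff, Finset.mem_univ, true_and, Finset.mem_insert,
      Finset.mem_singleton, not_or] at hz
    exact h' z hz.1 hz.2.1 hz.2.2 hzf.symm
  have hkeep_inner {x y : V} (h : G.Adj x y) (hxa : x ≠ a) (hxb : x ≠ b) (hya : y ≠ a)
      (hyb : y ≠ b) : F.Adj x y := by
    refine hkeep h fun z hza hzb _ he ↦ ?_
    simp only [f, Sym2.eq_iff] at he
    grind
  -- A common neighbour of `x` and `y` is neither `a` nor `b`, while every deleted edge meets `a` or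
  -- `b`.
  have hcross {x y : V} (hx : ¬ G.Adj b x) (hxb : b ≠ x) (hy : ¬ G.Adj a y) (hya : a ≠ y) :
      F.Reachable x y := by
    by_cases hxy : x = y
    · rw [hxy]
    have hxa : x ≠ a := by rintro rfl; exact hx hadj.symm
    have hyb : y ≠ b := by rintro rfl; exact hy hadj
    obtain ⟨z, hxz, hyz⟩ := hc hxy
    have hza : z ≠ a := by rintro rfl; exact hy hyz.symm
    have hzb : z ≠ b := by rintro rfl; exact hx hxz.symm
    exact (hkeep_inner hxz hxa hxb.symm hza hzb).reachable.trans
      (hkeep_inner hyz hya.symm hyb hza hzb).reachable.symm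
  -- This is why `y₀` is left out of `S`: its edge to `b` ties the one-sided vertices to `b`.
  have hy₀b : F.Reachable y₀ b := by
    refine (hkeep ((hcover y₀).resolve_left hy₀) fun z hza hzb hzy he ↦ ?_).reachable.symm
    simp only [f, Sym2.eq_iff] at he
    grind
  have hreach (x : V) : F.Reachable x b := by
    by_cases hxb : x = b
    · rw [hxb]
    by_cases hxa : x = a
    · subst hxa
      refine (hkeep hadj fun z hza hzb _ he ↦ ?_).reachable
      simp only [f, Sym2.eq_iff] at he
      grind
    by_cases hbx : G.Adj b x
    · by_cases hax : G.Adj a x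
      · refine (hkeep hbx fun z hza hzb _ he ↦ ?_).reachable.symm
        simp only [f, Sym2.eq_iff] at he
        grind
      · exact (hcross hx₀ hbx₀ hax (Ne.symm hxa)).symm.trans
          ((hcross hx₀ hbx₀ hy₀ hay₀).trans hy₀b)
    · exact (hcross hbx (Ne.symm hxb) hy₀ hay₀).trans hy₀b
  have hF : F.Connected :=
    { preconnected := fun x y ↦ (hreach x).trans (hreach y).symm
      nonempty := ⟨v⟩ }
  -- With m edges in `G`, this reads n - 1 ≤ m - (n - 3).
  have hle := hF.card_vert_le_card_edgeSet_add_one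
  have hFcard : Nat.card F.edgeSet = G.edgeFinset.card - S.card := by
    rw [← Finset.card_image_of_injOn hfinj, ← Finset.card_sdiff_of_subset hfG,
      Nat.card_coe_set_eq, ← Set.ncard_coe_finset]
    simp [F]
  have hScard_le : S.card ≤ G.edgeFinset.card := by
    rw [← Finset.card_image_of_injOn hfinj]
    exact Finset.card_le_card hfG
  rw [hFcard, Nat.card_eq_fintype_card] at hle
  omega

/-- A nontrivial graph without universal vertices, in which any two vertices have a common
neighbour, has at least `2 n - 4` edges. -/
lemma HasCommonNeighbors.two_mul_card_le [Nontrivial V] (hc : G.HasCommonNeighbors)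
    (hdom : ¬ ∃ v : V, G.IsUniversal v) : 2 * Fintype.card V ≤ G.edgeFinset.card + 4 := by
  obtain ⟨v, hv⟩ := G.exists_minimal_degree_vertex
  have hmin (w : V) : G.degree v ≤ G.degree w := hv ▸ G.minDegree_le_degree w
  obtain h2 | h3 | h4 : G.degree v = 2 ∨ G.degree v = 3 ∨ 4 ≤ G.degree v := by
    have := hc.two_le_degree v
    omega
  · exact hc.two_mul_card_le_of_degree_eq_two hdom h2
  -- Twice the edge count is at least 4n - 7.
  · have := hc.le_two_mul_card_edgeFinset h3 (fun w ↦ h3 ▸ hmin w)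
    omega
  · have := Finset.card_nsmul_le_sum Finset.univ (G.degree ·) 4 fun w _ ↦ h4.trans (hmin w)
    rw [sum_degrees_eq_twice_card_edges, Finset.card_univ, smul_eq_mul] at this
    omega

end Finite

/-- If an edge `uv` lies in no triangle, then the sum of the rows of `u` and `v` is a nonzero
`{0, 1}`-vector of the row space which is not a row. -/
lemma exists_zero_one_mem_adjRowSpace {G : SimpleGraph V} [DecidableRel G.Adj] {u v : V}
    (huv : G.Adj u v) (htri : ∀ w, G.Adj u w → ¬ G.Adj v w) :
    ∃ x : V → ℝ, x ≠ 0 ∧ (∀ i, x i = 0 ∨ x i = 1) ∧ x ∈ G.adjRowSpace ∧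
      ∀ w : V, x ≠ (G.adjMatrix ℝ).row w := by
  refine ⟨(G.adjMatrix ℝ).row u + (G.adjMatrix ℝ).row v, fun h ↦ ?_, fun i ↦ ?_,
    add_mem (Submodule.subset_span ⟨u, rfl⟩) (Submodule.subset_span ⟨v, rfl⟩), fun w h ↦ ?_⟩
  · have := congrFun h v
    simp [Matrix.row, huv] at this
  · have := htri i
    by_cases h₁ : G.Adj u i <;> by_cases h₂ : G.Adj v i <;> simp_all [Matrix.row]
  · have h₁ := congrFun h u
    have h₂ := congrFun h v
    simp only [Matrix.row, Pi.add_apply, adjMatrix_apply, huv, huv.symm, G.irrefl, if_true,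
      if_false, zero_add, add_zero] at h₁ h₂
    have hwu : G.Adj w u := by by_contra h; simp [h] at h₁
    have hwv : G.Adj w v := by by_contra h; simp [h] at h₂
    exact htri w hwu.symm hwv.symm

end SimpleGraph

theorem theorem3p3 {V : Type*} [Fintype V] [DecidableEq V] (G : SimpleGraph V)
    [DecidableRel G.Adj] (hdiam : G.diam = 2) (hdom : ¬ ∃ v : V, G.IsUniversal v)
    (hsize : (G.edgeFinset.card : ℤ) = 2 * (Fintype.card V : ℤ) - 5) :
    ∃ x : V → ℝ, x ≠ 0 ∧ (∀ i, x i = 0 ∨ x i = 1) ∧ x ∈ G.adjRowSpace ∧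
      ∀ v : V, x ≠ (G.adjMatrix ℝ).row v := by
  by_cases htri : ∀ u v, G.Adj u v → ∃ w, G.Adj u w ∧ G.Adj v w
  · have : Nontrivial V := SimpleGraph.nontrivial_of_diam_ne_zero (by omega : G.diam ≠ 0)
    have := (SimpleGraph.hasCommonNeighbors_of_diam_eq_two hdiam htri).two_mul_card_le hdom
    omega
  · push Not at htri
    obtain ⟨u, v, huv, h⟩ := htri
    exact SimpleGraph.exists_zero_one_mem_adjRowSpace huv h
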